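/- For real numbers $a,b>0$ let $$\Phi_{a,b}(z)=\sum_{k=0}^{\infty}\frac{(a)_k}{(a+b)_k}\,\frac{z^k}{k!},\qquad (x)_k=x(x+1)\cdots(x+k-1),$$ be the Kummer function ${}_1F_1(a;a+b;z)$, and let $$\zeta^{H}_{a,b}(s)=\sum_{k\ge 1}\frac{1}{z_{k}^{\,s}}$$ be the hypergeometric zeta function, where $z_1,z_2,\dots$ are the complex zeros of $\Phi_{a,b}$, repeated according to multiplicity. Let $B(u,v)=\int_0^1x^{u-1}(1-x)^{v-1}\,dx$ be the beta function. (i) For all $a,b>0$, the series $\zeta^{H}_{a,b}(n)$ converges absolutely for every integer $n\ge 2$, and for every integer $p\ge 1$ $$\sum_{\ell=1}^{p} B(a+p-\ell,b)\,\frac{p!}{(p-\ell)!}\,\zeta^{H}_{a,b}(\ell+1)=-\frac{bp}{(a+b)(a+b+p)}\,B(a+p,b).$$ (ii) For every integer $n\ge 2$, the value $\zeta^{H}_{a,b}(n)$ is a rational function of $a$ and $b$: there are polynomials $P,Q\in\mathbb{Q}[x,y]$, depending only on $n$, such that for all $a,b>0$ one has $Q(a,b)\ne 0$ and $\zeta^{H}_{a,b}(n)=P(a,b)/Q(a,b)$.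 -/

import Mathlib

/-- The Kummer function `M(a, c; z) = ∑ₖ (a)ₖ / (c)ₖ * z ^ k / k!`, where `(x)ₖ` is the rising
factorial `x (x + 1) ⋯ (x + k - 1)`. -/
noncomputable def kummerM (a c z : ℂ) : ℂ :=
  ∑' k : ℕ, (ascPochhammer ℂ k).eval a / (ascPochhammer ℂ k).eval c *
    (z ^ k / (Nat.factorial k : ℂ))

/-- The function `Φ_{a,b}(z) = M(a, a + b; z)`. -/
noncomputable def kummerPhi (a b : ℝ) (z : ℂ) : ℂ :=
  kummerM (a : ℂ) ((a : ℂ) + (b : ℂ)) z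

/-- The set of complex zeros of `Φ_{a,b}`. -/
def kummerZeros (a b : ℝ) : Set ℂ := {z : ℂ | kummerPhi a b z = 0}

/-- The contribution of a zero `z` of `Φ_{a,b}` to the series of the hypergeometric zeta function:
`1 / z ^ s` (principal branch), counted with the multiplicity of the zero. -/
noncomputable def hypergeometricZetaTerm (a b : ℝ) (s : ℂ) (z : kummerZeros a b) : ℂ :=
  (analyticOrderNatAt (kummerPhi a b) (z : ℂ) : ℂ) * (1 / (z : ℂ) ^ s)

/-- The hypergeometric zeta function: the sum of `1 / z ^ s` over the complex zeros `z` of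
`Φ_{a,b}`, repeated according to multiplicity. -/
noncomputable def hypergeometricZeta (a b : ℝ) (s : ℂ) : ℂ :=
  ∑' z : kummerZeros a b, hypergeometricZetaTerm a b s z

/-! `kummerPhi a b` is entire with value 1 at the origin, and its Taylor coefficients `kummerCoeff a
b k` have norm at most 1, so it is bounded by `exp ‖z‖`. Everything about its zeros follows from
this growth; no Hadamard product is needed.

Let `f` be such a function. Dividing out its zeros in the ball of radius `R` leaves a quotient `g`,
zero-free there and of size `exp (O(R))` by the maximum principle. At the origin this bound gives
`O(R)` zeros, hence absolute convergence of the power sums for exponents at least 2. Applied to a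
logarithm of `g`, the Borel–Carathéodory and Cauchy estimates show that the `n`-th derivative of
`g'/g` at 0 is `O(R⁻ⁿ)`. Letting `R → ∞` identifies the power sum of exponent `n + 1` with
`-(f'/f)⁽ⁿ⁾(0) / n!` for `n ≥ 1` (`factorial_mul_tsum_analyticOrderNatAt`).

The Leibniz rule for `f' = (f'/f) f` then gives a recursion between power sums and Taylor
coefficients (`kummerCoeff_succ_eq_sub_sum`). Multiplied by `B(a, b)` it is the beta identity;
solved for its last power sum it gives rationality by induction. -/

section

open Filter Topology

/-! ### Dividing zeros out of an entire function -/

/-- An entire function that is not identically zero has finite order everywhere. -/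
theorem Differentiable.analyticOrderAt_ne_top {f : ℂ → ℂ} (hf : Differentiable ℂ f) {x : ℂ}
    (hx : f x ≠ 0) (w : ℂ) : analyticOrderAt f w ≠ ⊤ := by
  refine AnalyticOnNhd.analyticOrderAt_ne_top_of_isPreconnected
    (fun z _ => hf.analyticAt z) isPreconnected_univ (Set.mem_univ x) (Set.mem_univ w) ?_
  rw [((hf.analyticAt x).analyticOrderAt_eq_zero).2 hx]
  simp

/-- The zero of an entire function at a nonzero point can be divided out. -/
theorem Differentiable.exists_eq_one_sub_div_pow_mul {g : ℂ → ℂ} (hg : Differentiable ℂ g)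
    {w : ℂ} (hw : w ≠ 0) (htop : analyticOrderAt g w ≠ ⊤) :
    ∃ h : ℂ → ℂ, Differentiable ℂ h ∧ h w ≠ 0 ∧
      ∀ z, g z = (1 - z / w) ^ analyticOrderNatAt g w * h z := by
  set m := analyticOrderNatAt g w with hm
  obtain ⟨u, hu, hu0, hgu⟩ := ((hg.analyticAt w).analyticOrderNatAt_eq_iff htop).1 hm.symm
  have hfac : ∀ z : ℂ, z ≠ w → (1 - z / w) ≠ 0 := by
    intro z hz h
    exact hz (by field_simp at h; linear_combination -h)
  have hsub : ∀ z : ℂ, (z - w) ^ m = (1 - z / w) ^ m * (-w) ^ m := by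
    intro z
    rw [← mul_pow]
    congr 1
    field_simp
    ring
  -- The value at `w` fills the removable singularity: near `w` the quotient is `(-w) ^ m * u z`,
  -- because `z - w = (1 - z / w) * (-w)`.
  set h : ℂ → ℂ := Function.update (fun z => g z / (1 - z / w) ^ m) w ((-w) ^ m * u w) with hh
  have hne : ∀ z, z ≠ w → h z = g z / (1 - z / w) ^ m := fun z hz => by
    simp [hh, Function.update_of_ne hz]
  have hself : h w = (-w) ^ m * u w := by simp [hh]
  have hnear : h =ᶠ[𝓝 w] fun z => (-w) ^ m * u z := by
    filter_upwards [hgu] with z hz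
    rcases eq_or_ne z w with rfl | hzw
    · exact hself
    · rw [hne z hzw, hz, hsub, smul_eq_mul]
      have := pow_ne_zero m (hfac z hzw)
      field_simp
  refine ⟨h, fun z => ?_, ?_, fun z => ?_⟩
  · rcases eq_or_ne z w with rfl | hzw
    · exact (hu.differentiableAt.const_mul _).congr_of_eventuallyEq hnear
    · have : h =ᶠ[𝓝 z] fun z => g z / (1 - z / w) ^ m := by
        filter_upwards [isOpen_ne.mem_nhds hzw] with y hy using hne y hy
      refine DifferentiableAt.congr_of_eventuallyEq ?_ this
      exact (hg z).div (by fun_prop) (pow_ne_zero m (hfac z hzw))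
  · rw [hself]
    exact mul_ne_zero (pow_ne_zero _ (neg_ne_zero.2 hw)) hu0
  · rcases eq_or_ne z w with rfl | hzw
    · rw [hself, hgu.self_of_nhds, hsub, smul_eq_mul, mul_assoc]
    · rw [hne z hzw, mul_div_cancel₀ _ (pow_ne_zero m (hfac z hzw))]

/-- Finitely many zeros of an entire function can be divided out, with multiplicity. -/
theorem Differentiable.exists_eq_prod_mul {f : ℂ → ℂ} (hf : Differentiable ℂ f) (h0 : f 0 = 1)
    (S : Finset ℂ) (hS : 0 ∉ S) :
    ∃ g : ℂ → ℂ, Differentiable ℂ g ∧ g 0 = 1 ∧ (∀ w ∈ S, g w ≠ 0) ∧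
      ∀ z, f z = (∏ w ∈ S, (1 - z / w) ^ analyticOrderNatAt f w) * g z := by
  classical
  induction S using Finset.induction_on with
  | empty => exact ⟨f, hf, h0, by simp, by simp⟩
  | insert w S hwS ih =>
    have hw : w ≠ 0 := fun h => hS (by simp [h])
    obtain ⟨g, hg, hg0, hgS, hfg⟩ := ih fun h => hS (Finset.mem_insert_of_mem h)
    have hgtop := hg.analyticOrderAt_ne_top (x := 0) (by simp [hg0]) w
    obtain ⟨h, hh, hhw, hgh⟩ := hg.exists_eq_one_sub_div_pow_mul hw hgtop
    set P : ℂ → ℂ := fun z => ∏ u ∈ S, (1 - z / u) ^ analyticOrderNatAt f u with hP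
    have hPd : Differentiable ℂ P := by fun_prop
    have hPw : P w ≠ 0 := by
      refine Finset.prod_ne_zero_iff.2 fun u hu => pow_ne_zero _ fun h => ?_
      have hu0 : u ≠ 0 := fun h => hS (by simp [← h, hu])
      have : u = w := by field_simp at h; linear_combination h
      exact hwS (this ▸ hu)
    -- The factors already removed do not vanish at `w`, so the multiplicity of `w` is still the one
    -- in `f`.
    have hord : analyticOrderNatAt f w = analyticOrderNatAt g w := by
      have hfun : f = P * g := funext hfg
      have hPo : analyticOrderAt P w = 0 :=
        ((hPd.analyticAt w).analyticOrderAt_eq_zero).2 hPw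
      rw [hfun, analyticOrderNatAt_mul (hPd.analyticAt w) (hg.analyticAt w) (by simp [hPo]) hgtop,
        analyticOrderNatAt, hPo]
      simp
    have hh0 : h 0 = 1 := by simpa [hg0] using (hgh 0).symm
    refine ⟨h, hh, hh0, fun u hu => ?_, fun z => ?_⟩
    · rcases Finset.mem_insert.1 hu with rfl | hu
      · exact hhw
      · intro h
        exact hgS u hu (by rw [hgh, h, mul_zero])
    · rw [Finset.prod_insert hwS, hfg z, hgh z, hord]
      ring

/-- A nonzero entire function has finitely many zeros in every closed ball. -/
theorem Differentiable.finite_zeros_inter_closedBall {f : ℂ → ℂ} (hf : Differentiable ℂ f) {x : ℂ}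
    (hx : f x ≠ 0) (R : ℝ) : ({z | f z = 0} ∩ Metric.closedBall 0 R).Finite := by
  by_contra hinf
  obtain ⟨y, -, hy⟩ := Set.Infinite.exists_accPt_of_subset_isCompact hinf
    (isCompact_closedBall (0 : ℂ) R) Set.inter_subset_right
  have hfreq : ∃ᶠ z in 𝓝[≠] y, f z = 0 :=
    (accPt_iff_frequently_nhdsNE.1 hy).mono fun z hz => hz.1
  exact hx (AnalyticOnNhd.eqOn_zero_of_preconnected_of_frequently_eq_zero
    (fun z _ => hf.analyticAt z) isPreconnected_univ (Set.mem_univ y) hfreq (Set.mem_univ x))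

/-! ### Growth of the quotient and of its logarithmic derivative -/

/-- Dividing an entire function of exponential type by factors belonging to zeros in a ball of
radius `R` improves the growth bound on the ball of radius `4 * R`. -/
theorem norm_mul_three_pow_le_exp {f g : ℂ → ℂ} {C R : ℝ} (hg : Differentiable ℂ g)
    (hR : 0 < R) (hbound : ∀ z, ‖f z‖ ≤ Real.exp (C * ‖z‖)) {S : Finset ℂ} {m : ℂ → ℕ}
    (h0 : 0 ∉ S) (hS : ∀ w ∈ S, ‖w‖ ≤ R)
    (hfg : ∀ z, f z = (∏ w ∈ S, (1 - z / w) ^ m w) * g z) {z : ℂ} (hz : ‖z‖ ≤ 4 * R) :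
    ‖g z‖ * 3 ^ (∑ w ∈ S, m w) ≤ Real.exp (C * (4 * R)) := by
  have hsphere : ∀ z : ℂ, ‖z‖ = 4 * R →
      (3 : ℝ) ^ (∑ w ∈ S, m w) ≤ ‖∏ w ∈ S, (1 - z / w) ^ m w‖ := by
    intro z hz
    rw [norm_prod, ← Finset.prod_pow_eq_pow_sum]
    refine Finset.prod_le_prod (fun _ _ => by positivity) fun w hw => ?_
    rw [norm_pow]
    refine pow_le_pow_left₀ (by norm_num) ?_ _
    have hw0 : 0 < ‖w‖ := norm_pos_iff.2 fun h => h0 (h ▸ hw)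
    -- The radius `4 * R` is chosen so that each factor satisfies `‖1 - z / w‖ ≥ 4 - 1 = 3` on the
    -- sphere; 3 exceeds `e`, which the zero count uses.
    have h4 : 4 ≤ ‖z / w‖ := by
      rw [norm_div, hz, le_div_iff₀ hw0]
      linarith [hS w hw]
    have := norm_sub_norm_le (z / w) 1
    rw [norm_one, norm_sub_rev] at this
    linarith
  rw [← le_div_iff₀ (by positivity)]
  refine Complex.norm_le_of_forall_mem_frontier_norm_le (U := Metric.ball (0 : ℂ) (4 * R))
    Metric.isBounded_ball hg.diffContOnCl (fun z hz => ?_) ?_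
  · rw [frontier_ball _ (by positivity), mem_sphere_zero_iff_norm] at hz
    rw [le_div_iff₀ (by positivity)]
    calc ‖g z‖ * 3 ^ (∑ w ∈ S, m w)
        ≤ ‖g z‖ * ‖∏ w ∈ S, (1 - z / w) ^ m w‖ := by gcongr; exact hsphere z hz
      _ = ‖f z‖ := by rw [hfg z, norm_mul, mul_comm]
      _ ≤ _ := by rw [← hz]; exact hbound z
  · rw [closure_ball _ (by positivity), mem_closedBall_zero_iff]
    exact hz

/-- Borel–Carathéodory and Cauchy bounds for the Taylor coefficients of the logarithmic derivative
of a zero-free function. -/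
theorem norm_iteratedDeriv_logDeriv_le {g : ℂ → ℂ} {M R : ℝ} (hg : Differentiable ℂ g)
    (h0 : g 0 = 1) (hR : 0 < R) (hM : 0 < M) (hne : ∀ z ∈ Metric.ball (0 : ℂ) R, g z ≠ 0)
    (hbound : ∀ z ∈ Metric.ball (0 : ℂ) R, ‖g z‖ ≤ Real.exp M) (n : ℕ) :
    ‖iteratedDeriv n (logDeriv g) 0‖ ≤ (n + 1).factorial * (2 * M) / (R / 2) ^ (n + 1) := by
  have hld : DifferentiableOn ℂ (logDeriv g) (Metric.ball 0 R) := by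
    intro z hz
    exact ((hg.analyticAt z).deriv.differentiableAt.div (hg z) (hne z hz)).differentiableWithinAt
  -- The primitive of `g'/g` vanishing at 0 is a holomorphic logarithm of `g`, and the bound on
  -- `‖g‖` bounds its real part.
  obtain ⟨L, hL0, hL⟩ := hld.isExactOn_ball.with_val_at 0 0
  have h0mem : (0 : ℂ) ∈ Metric.ball (0 : ℂ) R := by simpa using hR
  have hLd : DifferentiableOn ℂ L (Metric.ball 0 R) :=
    fun z hz => (hL z hz).differentiableAt.differentiableWithinAt
  have hexp : Set.EqOn g (fun z => Complex.exp (L z)) (Metric.ball 0 R) := by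
    have key : Set.EqOn (logDeriv g) (logDeriv fun z => Complex.exp (L z)) (Metric.ball 0 R) := by
      intro z hz
      rw [logDeriv_apply (fun z => Complex.exp (L z)), (hL z hz).cexp.deriv]
      field_simp [Complex.exp_ne_zero]
    obtain ⟨c, -, hc⟩ := (logDeriv_eqOn_iff hg.differentiableOn hLd.cexp Metric.isOpen_ball
      (convex_ball _ _).isPreconnected (fun z _ => Complex.exp_ne_zero _) hne).1 key
    have hc1 : c = 1 := by simpa [h0, hL0] using (hc h0mem).symm
    intro z hz
    simpa [hc1] using hc hz
  have hmaps : Set.MapsTo L (Metric.ball 0 R) {z | z.re ≤ M} := by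
    intro z hz
    have := hbound z hz
    rw [hexp hz, Complex.norm_exp, Real.exp_le_exp] at this
    exact this
  have hLbound : ∀ z ∈ Metric.sphere (0 : ℂ) (R / 2), ‖L z‖ ≤ 2 * M := by
    intro z hz
    rw [mem_sphere_zero_iff_norm] at hz
    -- At half the radius the factor `2 * M * r / (R - r)` equals `2 * M`.
    have := Complex.borelCaratheodory_zero hM hLd hmaps hR
      (by rw [mem_ball_zero_iff, hz]; linarith) hL0
    rw [hz] at this
    convert this using 1
    field_simp
    ring
  have hclos : closure (Metric.ball (0 : ℂ) (R / 2)) ⊆ Metric.ball 0 R :=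
    Metric.closure_ball_subset_closedBall.trans (Metric.closedBall_subset_ball (by linarith))
  have hcauchy := Complex.norm_iteratedDeriv_le_of_forall_mem_sphere_norm_le (n + 1)
    (half_pos hR) (hLd.mono hclos).diffContOnCl hLbound
  rw [iteratedDeriv_succ'] at hcauchy
  have heq : deriv L =ᶠ[𝓝 0] logDeriv g := by
    filter_upwards [Metric.isOpen_ball.mem_nhds h0mem] with z hz using (hL z hz).deriv
  rwa [heq.iteratedDeriv_eq n] at hcauchy

/-- Geometric series: the logarithmic derivative is `m / (z - w) = -m * ∑ zⁿ / wⁿ⁺¹` near 0. -/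
theorem iteratedDeriv_mul_logDeriv_one_sub_div {w : ℂ} (hw : w ≠ 0) (m n : ℕ) :
    iteratedDeriv n (logDeriv fun z => (1 - z / w) ^ m) 0 =
      -(n.factorial * (m * (1 / w ^ (n + 1)))) := by
  have h : (logDeriv fun z => (1 - z / w) ^ m) = fun z => (m : ℂ) * (1 * z + (-w))⁻¹ := by
    funext z
    rw [logDeriv_fun_pow (by fun_prop), logDeriv_apply]
    congr 1
    rw [deriv_const_sub, deriv_div_const, deriv_id'']
    -- At the pole both sides are 0 by the convention for division by zero, so the functions agree
    -- everywhere.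
    rcases eq_or_ne z w with rfl | hzw
    · simp [hw]
    · have h1 : w - z ≠ 0 := sub_ne_zero.2 hzw.symm
      have h2 : z + -w ≠ 0 := by rwa [← sub_eq_add_neg, sub_ne_zero]
      field_simp
      ring
  rw [h, iteratedDeriv_const_mul_field, iteratedDeriv_eq_iterate, iter_deriv_inv_linear]
  have : (-1 - (n : ℤ)) = -((n + 1 : ℕ) : ℤ) := by push_cast; ring
  simp only [this, zpow_neg, zpow_natCast, mul_zero, zero_add, one_pow, mul_one, neg_pow w]
  have h1 : ((-1 : ℂ) ^ n) ≠ 0 := pow_ne_zero _ (by norm_num)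
  rw [pow_succ (-1 : ℂ)]
  field_simp

/-- The Taylor coefficients of the logarithmic derivative after dividing out zeros. -/
theorem iteratedDeriv_logDeriv_eq_sum {f g : ℂ → ℂ} {S : Finset ℂ} {m : ℂ → ℕ}
    (hg : Differentiable ℂ g) (hg0 : g 0 = 1) (h0 : 0 ∉ S)
    (hfg : ∀ z, f z = (∏ w ∈ S, (1 - z / w) ^ m w) * g z) (n : ℕ) :
    iteratedDeriv n (logDeriv f) 0 =
      -(n.factorial * ∑ w ∈ S, (m w : ℂ) * (1 / w ^ (n + 1))) +
        iteratedDeriv n (logDeriv g) 0 := by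
  have hfac : ∀ᶠ z in 𝓝 (0 : ℂ), ∀ w ∈ S, (1 - z / w) ^ m w ≠ 0 := by
    rw [Filter.eventually_all_finset]
    intro w hw
    have hc : ContinuousAt (fun z : ℂ => (1 - z / w) ^ m w) 0 := by fun_prop
    exact hc.eventually_ne (by simp)
  have hgne : ∀ᶠ z in 𝓝 (0 : ℂ), g z ≠ 0 :=
    (hg 0).continuousAt.eventually_ne (by simp [hg0])
  have hev : logDeriv f =ᶠ[𝓝 0]
      fun z => (∑ w ∈ S, logDeriv (fun z => (1 - z / w) ^ m w) z) + logDeriv g z := by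
    filter_upwards [hfac, hgne] with z h1 h2
    rw [funext hfg, logDeriv_mul z (Finset.prod_ne_zero_iff.2 h1) h2 (by fun_prop) (hg z),
      logDeriv_prod h1 (fun _ _ => by fun_prop)]
  have hcd : ∀ h : ℂ → ℂ, Differentiable ℂ h → h 0 ≠ 0 → ContDiffAt ℂ n (logDeriv h) 0 :=
    fun h hd h0 => ((hd.analyticAt 0).deriv.div (hd.analyticAt 0) h0).contDiffAt
  rw [hev.iteratedDeriv_eq,
    iteratedDeriv_fun_add (ContDiffAt.sum fun w _ => hcd _ (by fun_prop) (by simp))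
    (hcd g hg (by simp [hg0])), iteratedDeriv_fun_sum fun w _ => hcd _ (by fun_prop) (by simp)]
  congr 1
  rw [Finset.mul_sum, ← Finset.sum_neg_distrib]
  refine Finset.sum_congr rfl fun w hw => ?_
  exact iteratedDeriv_mul_logDeriv_one_sub_div (fun h => h0 (h ▸ hw)) _ _

/-! ### Counting zeros and power sums of their inverses -/

/-- An entire function of exponential type has `O(R)` zeros in the ball of radius `R`. -/
theorem sum_analyticOrderNatAt_le {f : ℂ → ℂ} {C R : ℝ} (hf : Differentiable ℂ f) (h0 : f 0 = 1)
    (hbound : ∀ z, ‖f z‖ ≤ Real.exp (C * ‖z‖)) (hR : 0 < R) {S : Finset ℂ}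
    (hzero : ∀ w ∈ S, f w = 0) (hS : ∀ w ∈ S, ‖w‖ ≤ R) :
    (∑ w ∈ S, (analyticOrderNatAt f w : ℝ)) ≤ 4 * C * R := by
  have hS0 : 0 ∉ S := fun h => by simpa [h0] using hzero 0 h
  obtain ⟨g, hg, hg0, -, hfg⟩ := hf.exists_eq_prod_mul h0 S hS0
  have h3 := norm_mul_three_pow_le_exp hg hR hbound hS0 hS hfg (z := 0) (by simpa using hR.le)
  set N := ∑ w ∈ S, analyticOrderNatAt f w with hN
  rw [hg0, norm_one, one_mul] at h3
  -- Since `g 0 = 1`, the growth bound at the origin reads `3 ^ N ≤ exp (4 * C * R)`, and `e < 3`.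
  have he : Real.exp N ≤ Real.exp (C * (4 * R)) := by
    refine le_trans ?_ h3
    rw [← mul_one (N : ℝ), Real.exp_nat_mul]
    exact pow_le_pow_left₀ (Real.exp_pos _).le Real.exp_one_lt_three.le _
  rw [Real.exp_le_exp] at he
  have : (∑ w ∈ S, (analyticOrderNatAt f w : ℝ)) = N := by simp [hN]
  linarith

/-- A function continuous and nonzero at the origin has its zeros bounded away from it. -/
theorem ContinuousAt.exists_pos_le_norm_of_eq_zero {f : ℂ → ℂ} (hf : ContinuousAt f 0)
    (h0 : f 0 ≠ 0) : ∃ r > 0, ∀ z, f z = 0 → r ≤ ‖z‖ := by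
  obtain ⟨r, hr, h⟩ := Metric.eventually_nhds_iff.1 (hf.eventually_ne h0)
  refine ⟨r, hr, fun z hz => ?_⟩
  by_contra! hlt
  exact h (by simpa using hlt) hz

/-- Dyadic bookkeeping: a zero assigned to level `j` lies in the ball of radius `2 ^ j` and has
weight `O(4⁻ʲ)`. Zeros in the unit disc go to level 0, where the term `1 / r ^ 2` covers them. -/
theorem exists_norm_le_two_pow_and_one_div_sq_le {r : ℝ} (hr : 0 < r) {z : ℂ} (hz : r ≤ ‖z‖) :
    ∃ j : ℕ, ‖z‖ ≤ 2 ^ j ∧ 1 / ‖z‖ ^ 2 ≤ (4 + 1 / r ^ 2) * (1 / 4) ^ j := by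
  have hz0 : 0 < ‖z‖ := hr.trans_le hz
  rcases le_total ‖z‖ 1 with h1 | h1
  · refine ⟨0, by simpa using h1, ?_⟩
    have : 1 / ‖z‖ ^ 2 ≤ 1 / r ^ 2 := by gcongr
    rw [pow_zero, mul_one]
    linarith
  · obtain ⟨n, hn, hn'⟩ := exists_nat_pow_near h1 (one_lt_two (α := ℝ))
    refine ⟨n + 1, hn'.le, ?_⟩
    calc 1 / ‖z‖ ^ 2 ≤ 1 / (2 ^ n) ^ 2 := by gcongr
      _ = 4 * (1 / 4) ^ (n + 1) := by
        rw [← pow_mul, mul_comm n 2, pow_mul, pow_succ, one_div_pow]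
        norm_num
        ring
      _ ≤ _ := by gcongr; exact le_add_of_nonneg_right (by positivity)

/-- For an entire function of exponential type the inverse squares of the zeros are summable. -/
theorem summable_analyticOrderNatAt_mul_one_div_norm_sq {f : ℂ → ℂ} {C : ℝ}
    (hf : Differentiable ℂ f) (h0 : f 0 = 1) (hbound : ∀ z, ‖f z‖ ≤ Real.exp (C * ‖z‖)) :
    Summable fun z : {z | f z = 0} => (analyticOrderNatAt f z : ℝ) * (1 / ‖(z : ℂ)‖ ^ 2) := by
  obtain ⟨r, hr, hzr⟩ := (hf 0).continuousAt.exists_pos_le_norm_of_eq_zero (by simp [h0])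
  choose j hj hj' using fun z : {z | f z = 0} =>
    exists_norm_le_two_pow_and_one_div_sq_le hr (hzr z z.2)
  set M := 4 + 1 / r ^ 2 with hM
  have hM0 : 0 < M := by positivity
  have hC : 0 ≤ 4 * C := by
    simpa using sum_analyticOrderNatAt_le hf h0 hbound one_pos (S := ∅) (by simp) (by simp)
  refine summable_of_sum_le (c := M * (4 * C) * 2) (fun z => by positivity) fun S => ?_
  have hcount : ∀ i : ℕ, (∑ z ∈ S with j z = i, (analyticOrderNatAt f z : ℝ)) ≤ 4 * C * 2 ^ i := by
    intro i
    have := sum_analyticOrderNatAt_le hf h0 hbound (R := 2 ^ i) (by positivity)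
      (S := (S.filter fun z => j z = i).map (Function.Embedding.subtype _)) (by simp +contextual)
      (by
        intro w hw
        obtain ⟨z, hz, rfl⟩ := Finset.mem_map.1 hw
        exact (Finset.mem_filter.1 hz).2 ▸ hj z)
    rwa [Finset.sum_map] at this
  calc ∑ z ∈ S, (analyticOrderNatAt f z : ℝ) * (1 / ‖(z : ℂ)‖ ^ 2)
      ≤ ∑ z ∈ S, (analyticOrderNatAt f z : ℝ) * (M * (1 / 4) ^ j z) := by
        gcongr with z
        exact hj' z
    _ = ∑ i ∈ S.image j, ∑ z ∈ S with j z = i, (analyticOrderNatAt f z : ℝ) * (M * (1 / 4) ^ j z) :=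
        (Finset.sum_fiberwise_of_maps_to (fun z hz => Finset.mem_image_of_mem j hz) _).symm
    _ = ∑ i ∈ S.image j, (M * (1 / 4) ^ i) * ∑ z ∈ S with j z = i, (analyticOrderNatAt f z : ℝ) := by
        refine Finset.sum_congr rfl fun i _ => ?_
        rw [Finset.mul_sum]
        refine Finset.sum_congr rfl fun z hz => ?_
        rw [(Finset.mem_filter.1 hz).2, mul_comm]
    _ ≤ ∑ i ∈ S.image j, (M * (1 / 4) ^ i) * (4 * C * 2 ^ i) := by
        gcongr with i
        exact hcount i
    -- Level `i` has `O(2ⁱ)` zeros of weight `O(4⁻ⁱ)`, leaving a geometric series.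
    _ = M * (4 * C) * ∑ i ∈ S.image j, (1 / 2 : ℝ) ^ i := by
        rw [Finset.mul_sum]
        refine Finset.sum_congr rfl fun i _ => ?_
        rw [show (1 / 2 : ℝ) = 1 / 4 * 2 by norm_num, mul_pow]
        ring
    _ ≤ M * (4 * C) * 2 := by
        refine mul_le_mul_of_nonneg_left ?_ (by positivity)
        refine le_of_le_of_eq ?_ tsum_geometric_two
        exact summable_geometric_two.sum_le_tsum _ fun i _ => by positivity

theorem summable_analyticOrderNatAt_mul_one_div_pow {f : ℂ → ℂ} {C : ℝ}
    (hf : Differentiable ℂ f) (h0 : f 0 = 1) (hbound : ∀ z, ‖f z‖ ≤ Real.exp (C * ‖z‖))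
    {k : ℕ} (hk : 2 ≤ k) :
    Summable fun z : {z | f z = 0} => (analyticOrderNatAt f z : ℂ) * (1 / (z : ℂ) ^ k) := by
  obtain ⟨r, hr, hzr⟩ := (hf 0).continuousAt.exists_pos_le_norm_of_eq_zero (by simp [h0])
  obtain ⟨k, rfl⟩ := Nat.exists_eq_add_of_le hk
  refine Summable.of_norm_bounded
    ((summable_analyticOrderNatAt_mul_one_div_norm_sq hf h0 hbound).mul_right (1 / r ^ k))
    fun z => ?_
  have hz : r ≤ ‖(z : ℂ)‖ := hzr z z.2
  have hz0 : 0 < ‖(z : ℂ)‖ := hr.trans_le hz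
  rw [norm_mul, norm_div, norm_one, norm_pow, Complex.norm_natCast, pow_add, mul_assoc,
    ← one_div_mul_one_div]
  gcongr

/-- For an entire function of exponential type, the power sums of the inverse zeros are given by
the Taylor coefficients of the logarithmic derivative. -/
theorem factorial_mul_tsum_analyticOrderNatAt {f : ℂ → ℂ} {C : ℝ}
    (hf : Differentiable ℂ f) (h0 : f 0 = 1) (hC : 0 < C)
    (hbound : ∀ z, ‖f z‖ ≤ Real.exp (C * ‖z‖)) {n : ℕ} (hn : 1 ≤ n) :
    (n.factorial : ℂ) *
        ∑' z : {z | f z = 0}, (analyticOrderNatAt f z : ℂ) * (1 / (z : ℂ) ^ (n + 1)) =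
      -iteratedDeriv n (logDeriv f) 0 := by
  have hfin : ∀ R : ℝ, {z : {z | f z = 0} | ‖(z : ℂ)‖ ≤ R}.Finite := fun R => by
    refine Set.Finite.of_finite_image (f := Subtype.val) ?_ Subtype.val_injective.injOn
    refine (hf.finite_zeros_inter_closedBall (x := 0) (by simp [h0]) R).subset ?_
    rintro _ ⟨z, hz, rfl⟩
    exact ⟨z.2, by simpa using hz⟩
  set T : ℝ → Finset {z | f z = 0} := fun R => (hfin R).toFinset with hT
  have hTmem : ∀ R z, z ∈ T R ↔ ‖(z : ℂ)‖ ≤ R := fun R z => by simp [hT]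
  -- Unconditional summability allows the sum to be taken along growing balls.
  have hTtop : Tendsto T atTop atTop := by
    refine tendsto_atTop_finset_of_monotone (fun R R' h z hz => ?_) fun z => ⟨‖(z : ℂ)‖, ?_⟩
    · exact (hTmem _ _).2 (((hTmem _ _).1 hz).trans h)
    · exact (hTmem _ _).2 le_rfl
  have hlim := ((summable_analyticOrderNatAt_mul_one_div_pow hf h0 hbound
    (show 2 ≤ n + 1 by omega)).hasSum.comp hTtop).const_mul (n.factorial : ℂ)
  refine tendsto_nhds_unique hlim ?_
  rw [tendsto_iff_norm_sub_tendsto_zero]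
  -- This is the Cauchy bound with `M = C * (4 * R)`: one power of `R` cancels against `R ^ (n +
  -- 1)`, so the limit is 0 exactly because `n ≥ 1`.
  have hsq : Tendsto (fun R : ℝ => (n + 1).factorial * (2 * (C * 4)) * 2 ^ (n + 1) * (1 / R ^ n))
      atTop (𝓝 0) := by
    simpa using ((tendsto_pow_neg_atTop (𝕜 := ℝ) (n := n) (by omega)).const_mul
      (((n + 1).factorial : ℝ) * (2 * (C * 4)) * 2 ^ (n + 1)))
  refine squeeze_zero' (Eventually.of_forall fun _ => norm_nonneg _) ?_ hsq
  filter_upwards [eventually_gt_atTop 0] with R hR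
  set S : Finset ℂ := (T R).map (Function.Embedding.subtype _) with hS
  have hSmem : ∀ w, w ∈ S ↔ f w = 0 ∧ ‖w‖ ≤ R := fun w => by
    simp [hS, hTmem, and_comm]
  have hS0 : 0 ∉ S := fun h => by simpa [h0] using ((hSmem 0).1 h).1
  obtain ⟨g, hg, hg0, hgS, hfg⟩ := hf.exists_eq_prod_mul h0 S hS0
  have hgne : ∀ z ∈ Metric.ball (0 : ℂ) R, g z ≠ 0 := by
    intro z hz hgz
    refine hgS z ((hSmem z).2 ⟨by rw [hfg, hgz, mul_zero], ?_⟩) hgz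
    exact (mem_ball_zero_iff.1 hz).le
  have hgb : ∀ z ∈ Metric.ball (0 : ℂ) R, ‖g z‖ ≤ Real.exp (C * (4 * R)) := by
    intro z hz
    refine le_trans ?_ (norm_mul_three_pow_le_exp hg hR hbound hS0
      (fun w hw => ((hSmem w).1 hw).2) hfg (z := z) (by linarith [mem_ball_zero_iff.1 hz]))
    exact le_mul_of_one_le_right (norm_nonneg _) (one_le_pow₀ (by norm_num))
  have hle := norm_iteratedDeriv_logDeriv_le hg hg0 hR (by positivity) hgne hgb n
  have heq := iteratedDeriv_logDeriv_eq_sum hg hg0 hS0 hfg n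
  have hsum : ∑ w ∈ S, (analyticOrderNatAt f w : ℂ) * (1 / w ^ (n + 1)) =
      ∑ z ∈ T R, (analyticOrderNatAt f z : ℂ) * (1 / (z : ℂ) ^ (n + 1)) := by
    rw [hS, Finset.sum_map]
    rfl
  rw [hsum] at heq
  rw [heq]
  simp only [Function.comp_def]
  rw [neg_add, neg_neg, sub_add_cancel_left, neg_neg]
  refine hle.trans (le_of_eq ?_)
  rw [div_pow]
  field_simp
  ring

/-! ### Exponential series with coefficients bounded by 1 -/

section ExponentialSeries

variable {c : ℕ → ℂ}

theorem norm_mul_pow_div_factorial_le (hc : ∀ k, ‖c k‖ ≤ 1) (z : ℂ) (k : ℕ) :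
    ‖c k * (z ^ k / (k.factorial : ℂ))‖ ≤ ‖z‖ ^ k / k.factorial := by
  rw [norm_mul, norm_div, norm_pow, Complex.norm_natCast]
  exact mul_le_of_le_one_left (by positivity) (hc k)

theorem norm_tsum_mul_pow_div_factorial_le (hc : ∀ k, ‖c k‖ ≤ 1) (z : ℂ) :
    ‖∑' k, c k * (z ^ k / (k.factorial : ℂ))‖ ≤ Real.exp ‖z‖ := by
  rw [Real.exp_eq_exp_ℝ, NormedSpace.exp_eq_tsum_div]
  exact tsum_of_norm_bounded (Real.summable_pow_div_factorial ‖z‖).hasSum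
    (norm_mul_pow_div_factorial_le hc z)

theorem hasFPowerSeriesOnBall_tsum_mul_pow_div_factorial (hc : ∀ k, ‖c k‖ ≤ 1) :
    HasFPowerSeriesOnBall (fun z => ∑' k, c k * (z ^ k / (k.factorial : ℂ)))
      (FormalMultilinearSeries.ofScalars ℂ fun k => c k / (k.factorial : ℂ)) 0 ⊤ where
  r_le := by
    refine le_of_eq (FormalMultilinearSeries.radius_eq_top_of_summable_norm _ fun r => ?_).symm
    refine Summable.of_nonneg_of_le (fun _ => by positivity) (fun k => ?_)
      (Real.summable_pow_div_factorial r)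
    rw [FormalMultilinearSeries.ofScalars_norm, norm_div, Complex.norm_natCast, div_mul_eq_mul_div]
    gcongr
    exact mul_le_of_le_one_left (by positivity) (hc k)
  r_pos := by simp
  hasSum {y} _ := by
    have hs : Summable fun k => c k * (y ^ k / (k.factorial : ℂ)) :=
      (Real.summable_pow_div_factorial ‖y‖).of_norm_bounded (norm_mul_pow_div_factorial_le hc y)
    rw [zero_add]
    have hk : ∀ k, c k * (y ^ k / (k.factorial : ℂ)) =
        FormalMultilinearSeries.ofScalars ℂ (fun k => c k / (k.factorial : ℂ)) k fun _ => y :=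
      fun k => by
      rw [FormalMultilinearSeries.ofScalars_apply_eq, smul_eq_mul]
      ring
    simpa only [hk] using hs.hasSum

theorem differentiable_tsum_mul_pow_div_factorial (hc : ∀ k, ‖c k‖ ≤ 1) :
    Differentiable ℂ fun z => ∑' k, c k * (z ^ k / (k.factorial : ℂ)) := by
  have := (hasFPowerSeriesOnBall_tsum_mul_pow_div_factorial hc).differentiableOn
  rw [Metric.eball_top] at this
  exact differentiableOn_univ.1 this

theorem iteratedDeriv_tsum_mul_pow_div_factorial (hc : ∀ k, ‖c k‖ ≤ 1) (k : ℕ) :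
    iteratedDeriv k (fun z => ∑' k, c k * (z ^ k / (k.factorial : ℂ))) 0 = c k := by
  have h := (hasFPowerSeriesOnBall_tsum_mul_pow_div_factorial hc).hasFPowerSeriesAt
  have h' := h.eq_formalMultilinearSeries h.analyticAt.hasFPowerSeriesAt
  have := congrFun ((FormalMultilinearSeries.ofScalars_series_eq_iff ℂ _ _).1 h') k
  have hk : (k.factorial : ℂ) ≠ 0 := by exact_mod_cast k.factorial_ne_zero
  rw [div_left_inj' hk] at this
  exact this.symm

end ExponentialSeries

/-! ### The recursion between Taylor coefficients and power sums -/

/-- Leibniz recursion between the Taylor coefficients of a function and of its logarithmic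
derivative. -/
theorem AnalyticAt.iteratedDeriv_succ_eq_sum_logDeriv {f : ℂ → ℂ} {x : ℂ} (hf : AnalyticAt ℂ f x)
    (hx : f x ≠ 0) (p : ℕ) :
    iteratedDeriv (p + 1) f x = ∑ l ∈ Finset.range (p + 1),
      (p.choose l : ℂ) * iteratedDeriv l (logDeriv f) x * iteratedDeriv (p - l) f x := by
  have hev : deriv f =ᶠ[𝓝 x] logDeriv f * f := by
    filter_upwards [hf.continuousAt.eventually_ne hx] with z hz
    rw [Pi.mul_apply, logDeriv_apply, div_mul_cancel₀ _ hz]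
  rw [iteratedDeriv_succ', hev.iteratedDeriv_eq,
    iteratedDeriv_mul (f := logDeriv f) (hf.deriv.div hf hx).contDiffAt hf.contDiffAt]

/-- The Taylor coefficients of an entire function of exponential type are determined recursively
by the power sums of its inverse zeros. -/
theorem iteratedDeriv_succ_eq_sub_sum_descFactorial {f : ℂ → ℂ} {C : ℝ}
    (hf : Differentiable ℂ f) (h0 : f 0 = 1) (hC : 0 < C)
    (hbound : ∀ z, ‖f z‖ ≤ Real.exp (C * ‖z‖)) (p : ℕ) :
    iteratedDeriv (p + 1) f 0 = iteratedDeriv 1 f 0 * iteratedDeriv p f 0 -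
      ∑ i ∈ Finset.range p, (p.descFactorial (i + 1) : ℂ) *
        (∑' z : {z | f z = 0}, (analyticOrderNatAt f z : ℂ) * (1 / (z : ℂ) ^ (i + 2))) *
          iteratedDeriv (p - (i + 1)) f 0 := by
  -- The term `l = 0` is split off: it is `f'(0)`, since the power-sum formula starts only at
  -- exponent 2.
  rw [(hf.analyticAt 0).iteratedDeriv_succ_eq_sum_logDeriv (by simp [h0]), Finset.sum_range_succ',
    add_comm, sub_eq_add_neg, ← Finset.sum_neg_distrib]
  congr 1
  · simp [logDeriv_apply, h0, iteratedDeriv_one]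
  · refine Finset.sum_congr rfl fun i _ => ?_
    have := factorial_mul_tsum_analyticOrderNatAt hf h0 hC hbound (n := i + 1) (by omega)
    rw [← neg_eq_iff_eq_neg] at this
    rw [← this, Nat.descFactorial_eq_factorial_mul_choose]
    push_cast
    ring

/-! ### The Kummer function and the beta identity -/

/-- The Taylor coefficients `(a)ₖ / (a + b)ₖ` of the Kummer function. -/
noncomputable def kummerCoeff (a b : ℝ) (k : ℕ) : ℂ :=
  (ascPochhammer ℂ k).eval (a : ℂ) / (ascPochhammer ℂ k).eval ((a : ℂ) + (b : ℂ))

@[simp]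
theorem kummerCoeff_zero (a b : ℝ) : kummerCoeff a b 0 = 1 := by simp [kummerCoeff]

theorem kummerCoeff_succ (a b : ℝ) (k : ℕ) :
    kummerCoeff a b (k + 1) = kummerCoeff a b k * (((a : ℂ) + k) / ((a : ℂ) + b + k)) := by
  simp only [kummerCoeff, ascPochhammer_succ_eval, mul_div_mul_comm]

theorem hypergeometricZetaTerm_natCast (a b : ℝ) (n : ℕ) :
    hypergeometricZetaTerm a b (n : ℂ) = fun z : {z | kummerPhi a b z = 0} =>
      (analyticOrderNatAt (kummerPhi a b) z : ℂ) * (1 / (z : ℂ) ^ n) := by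
  funext z
  rw [hypergeometricZetaTerm, Complex.cpow_natCast]

section Kummer

variable {a b : ℝ}

theorem ofReal_add_natCast_ne_zero {c : ℝ} (hc : 0 < c) (k : ℕ) : (c : ℂ) + k ≠ 0 := by
  have : (0 : ℝ) < c + k := by positivity
  exact_mod_cast this.ne'

theorem norm_kummerCoeff_le_one (ha : 0 < a) (hb : 0 < b) (k : ℕ) : ‖kummerCoeff a b k‖ ≤ 1 := by
  induction k with
  | zero => simp
  | succ k ih =>
    rw [kummerCoeff_succ, norm_mul]
    refine mul_le_one₀ ih (norm_nonneg _) ?_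
    have h : ((a : ℂ) + k) / ((a : ℂ) + b + k) = ((a + k) / (a + b + k) : ℝ) := by push_cast; rfl
    rw [h, Complex.norm_of_nonneg (by positivity)]
    exact div_le_one_of_le₀ (by linarith) (by positivity)

theorem differentiable_kummerPhi (ha : 0 < a) (hb : 0 < b) : Differentiable ℂ (kummerPhi a b) :=
  differentiable_tsum_mul_pow_div_factorial (norm_kummerCoeff_le_one ha hb)

theorem iteratedDeriv_kummerPhi_zero (ha : 0 < a) (hb : 0 < b) (k : ℕ) :
    iteratedDeriv k (kummerPhi a b) 0 = kummerCoeff a b k :=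
  iteratedDeriv_tsum_mul_pow_div_factorial (norm_kummerCoeff_le_one ha hb) k

theorem kummerPhi_zero (ha : 0 < a) (hb : 0 < b) : kummerPhi a b 0 = 1 := by
  simpa using iteratedDeriv_kummerPhi_zero ha hb 0

theorem norm_kummerPhi_le (ha : 0 < a) (hb : 0 < b) (z : ℂ) :
    ‖kummerPhi a b z‖ ≤ Real.exp (1 * ‖z‖) := by
  rw [one_mul]
  exact norm_tsum_mul_pow_div_factorial_le (norm_kummerCoeff_le_one ha hb) z

theorem summable_hypergeometricZetaTerm (ha : 0 < a) (hb : 0 < b) {n : ℕ} (hn : 2 ≤ n) :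
    Summable (hypergeometricZetaTerm a b (n : ℂ)) := by
  rw [hypergeometricZetaTerm_natCast]
  exact summable_analyticOrderNatAt_mul_one_div_pow (differentiable_kummerPhi ha hb)
    (kummerPhi_zero ha hb) (norm_kummerPhi_le ha hb) hn

theorem kummerCoeff_succ_eq_sub_sum (ha : 0 < a) (hb : 0 < b) (p : ℕ) :
    kummerCoeff a b (p + 1) = kummerCoeff a b 1 * kummerCoeff a b p -
      ∑ i ∈ Finset.range p, (p.descFactorial (i + 1) : ℂ) *
        hypergeometricZeta a b ((i + 2 : ℕ) : ℂ) * kummerCoeff a b (p - (i + 1)) := by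
  have := iteratedDeriv_succ_eq_sub_sum_descFactorial (differentiable_kummerPhi ha hb)
    (kummerPhi_zero ha hb) one_pos (norm_kummerPhi_le ha hb) p
  simp only [iteratedDeriv_kummerPhi_zero ha hb] at this
  simp only [hypergeometricZeta, hypergeometricZetaTerm_natCast]
  exact this

/-- Raising the first argument of the beta function by 1 multiplies it by `(a + k) / (a + b + k)`,
the same ratio as in `kummerCoeff_succ`. -/
theorem betaIntegral_add_natCast (ha : 0 < a) (hb : 0 < b) (k : ℕ) :
    Complex.betaIntegral ((a : ℂ) + k) b = Complex.betaIntegral a b * kummerCoeff a b k := by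
  induction k with
  | zero => simp
  | succ k ih =>
    have hre : 0 < ((a : ℂ) + k).re := by simp; positivity
    have hre' : 0 < ((a : ℂ) + (k + 1 : ℕ)).re := by simp; positivity
    have hbre : 0 < (b : ℂ).re := by simpa using hb
    have h1 := ofReal_add_natCast_ne_zero ha k
    have h2 : (a : ℂ) + b + k ≠ 0 := by
      exact_mod_cast ofReal_add_natCast_ne_zero (add_pos ha hb) k
    rw [kummerCoeff_succ, ← mul_assoc, ← ih, Complex.betaIntegral_eq_Gamma_mul_div _ _ hre hbre,
      Complex.betaIntegral_eq_Gamma_mul_div _ _ hre' hbre, Nat.cast_succ, ← add_assoc,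
      Complex.Gamma_add_one _ h1, show (a : ℂ) + k + 1 + b = (a + b + k) + 1 by ring,
      Complex.Gamma_add_one _ h2, show (a : ℂ) + k + b = a + b + k by ring, div_mul_div_comm]
    ring

theorem sum_betaIntegral_mul_hypergeometricZeta (ha : 0 < a) (hb : 0 < b) (p : ℕ) :
    ∑ l ∈ Finset.Icc 1 p,
        Complex.betaIntegral ((a : ℂ) + (p : ℂ) - (l : ℂ)) (b : ℂ) *
          ((Nat.factorial p : ℂ) / (Nat.factorial (p - l) : ℂ)) *
          hypergeometricZeta a b ((l : ℂ) + 1) =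
      -((b : ℂ) * (p : ℂ) / (((a : ℂ) + (b : ℂ)) * ((a : ℂ) + (b : ℂ) + (p : ℂ)))) *
        Complex.betaIntegral ((a : ℂ) + (p : ℂ)) (b : ℂ) := by
  have hsum : ∑ l ∈ Finset.Icc 1 p,
        Complex.betaIntegral ((a : ℂ) + (p : ℂ) - (l : ℂ)) (b : ℂ) *
          ((Nat.factorial p : ℂ) / (Nat.factorial (p - l) : ℂ)) *
          hypergeometricZeta a b ((l : ℂ) + 1) =
      Complex.betaIntegral a b * ∑ i ∈ Finset.range p, (p.descFactorial (i + 1) : ℂ) *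
        hypergeometricZeta a b ((i + 2 : ℕ) : ℂ) * kummerCoeff a b (p - (i + 1)) := by
    rw [Finset.mul_sum]
    refine (Finset.sum_nbij (· + 1) (fun i hi => by simpa using Finset.mem_range.1 hi)
      (fun _ _ _ _ h => Nat.succ_injective h) (fun l hl => ?_) fun i hi => ?_).symm
    · obtain ⟨h1, h2⟩ := Finset.mem_Icc.1 hl
      exact ⟨l - 1, by simp; omega, by simp; omega⟩
    · have hi : i + 1 ≤ p := Finset.mem_range.1 hi
      have hf : ((p - (i + 1)).factorial : ℂ) ≠ 0 := by
        exact_mod_cast (p - (i + 1)).factorial_ne_zero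
      have hcast : (a : ℂ) + p - (i + 1 : ℕ) = a + (p - (i + 1) : ℕ) := by
        rw [Nat.cast_sub hi]; ring
      rw [hcast, betaIntegral_add_natCast ha hb, ← Nat.factorial_mul_descFactorial hi,
        Nat.cast_mul, mul_div_cancel_left₀ _ hf]
      push_cast
      ring_nf
  have h0 : (a : ℂ) + b ≠ 0 := by exact_mod_cast (add_pos ha hb).ne'
  have hp : (a : ℂ) + b + p ≠ 0 := by
    exact_mod_cast ofReal_add_natCast_ne_zero (add_pos ha hb) p
  have hrec := kummerCoeff_succ_eq_sub_sum ha hb p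
  have h1 : kummerCoeff a b 1 = (a : ℂ) / (a + b) := by simpa using kummerCoeff_succ a b 0
  rw [eq_sub_iff_add_eq, ← eq_sub_iff_add_eq'] at hrec
  -- The right-hand side comes from `a / (a + b) - (a + p) / (a + b + p) = -b * p / ((a + b) * (a +
  -- b + p))`.
  rw [hsum, hrec, kummerCoeff_succ a b p, h1, betaIntegral_add_natCast ha hb]
  field_simp
  ring

end Kummer

/-! ### Rationality in the parameters -/

/-- A function of two positive real parameters that agrees with a quotient of two rational
polynomials, the denominator having no zeros at positive parameters. -/
def IsRationalInParameters (F : ℝ → ℝ → ℂ) : Prop :=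
  ∃ P Q : MvPolynomial (Fin 2) ℚ, ∀ a b : ℝ, 0 < a → 0 < b →
    MvPolynomial.aeval ![(a : ℂ), (b : ℂ)] Q ≠ 0 ∧
    F a b = MvPolynomial.aeval ![(a : ℂ), (b : ℂ)] P / MvPolynomial.aeval ![(a : ℂ), (b : ℂ)] Q

namespace IsRationalInParameters

variable {F G : ℝ → ℝ → ℂ}

theorem congr (hF : IsRationalInParameters F) (h : ∀ a b : ℝ, 0 < a → 0 < b → G a b = F a b) :
    IsRationalInParameters G := by
  obtain ⟨P, Q, hPQ⟩ := hF
  exact ⟨P, Q, fun a b ha hb => ⟨(hPQ a b ha hb).1, (h a b ha hb).trans (hPQ a b ha hb).2⟩⟩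

theorem ratCast (q : ℚ) : IsRationalInParameters fun _ _ => (q : ℂ) :=
  ⟨MvPolynomial.C q, 1, fun a b _ _ => by simp⟩

theorem add (hF : IsRationalInParameters F) (hG : IsRationalInParameters G) :
    IsRationalInParameters fun a b => F a b + G a b := by
  obtain ⟨P, Q, hPQ⟩ := hF
  obtain ⟨P', Q', hPQ'⟩ := hG
  refine ⟨P * Q' + Q * P', Q * Q', fun a b ha hb => ?_⟩
  obtain ⟨h1, h2⟩ := hPQ a b ha hb
  obtain ⟨h1', h2'⟩ := hPQ' a b ha hb
  simp only [map_mul, map_add, h2, h2']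
  exact ⟨mul_ne_zero h1 h1', div_add_div _ _ h1 h1'⟩

theorem mul (hF : IsRationalInParameters F) (hG : IsRationalInParameters G) :
    IsRationalInParameters fun a b => F a b * G a b := by
  obtain ⟨P, Q, hPQ⟩ := hF
  obtain ⟨P', Q', hPQ'⟩ := hG
  refine ⟨P * P', Q * Q', fun a b ha hb => ?_⟩
  obtain ⟨h1, h2⟩ := hPQ a b ha hb
  obtain ⟨h1', h2'⟩ := hPQ' a b ha hb
  simp only [map_mul, h2, h2']
  exact ⟨mul_ne_zero h1 h1', div_mul_div_comm _ _ _ _⟩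

theorem sub (hF : IsRationalInParameters F) (hG : IsRationalInParameters G) :
    IsRationalInParameters fun a b => F a b - G a b :=
  (hF.add ((ratCast (-1)).mul hG)).congr fun a b _ _ => by push_cast; ring

theorem sum {ι : Type*} {F : ι → ℝ → ℝ → ℂ} (s : Finset ι)
    (hF : ∀ i ∈ s, IsRationalInParameters (F i)) :
    IsRationalInParameters fun a b => ∑ i ∈ s, F i a b := by
  classical
  induction s using Finset.induction_on with
  | empty => simpa using ratCast 0
  | insert i s hi ih =>
    simp only [Finset.sum_insert hi]
    exact (hF i (Finset.mem_insert_self i s)).add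
      (ih fun j hj => hF j (Finset.mem_insert_of_mem hj))

end IsRationalInParameters

theorem isRationalInParameters_kummerCoeff (k : ℕ) :
    IsRationalInParameters fun a b => kummerCoeff a b k := by
  induction k with
  | zero => simpa using IsRationalInParameters.ratCast 1
  | succ k ih =>
    simp only [kummerCoeff_succ]
    refine ih.mul ⟨MvPolynomial.X 0 + (k : MvPolynomial (Fin 2) ℚ),
      MvPolynomial.X 0 + MvPolynomial.X 1 + (k : MvPolynomial (Fin 2) ℚ), fun a b ha hb => ?_⟩
    simp only [map_add, MvPolynomial.aeval_X, map_natCast, Matrix.cons_val_zero,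
      Matrix.cons_val_one, and_true]
    exact_mod_cast ofReal_add_natCast_ne_zero (add_pos ha hb) k

/-- In the recursion at `p = n + 1` the last summand is `(n + 1)!` times the value at `n + 2`, as
`kummerCoeff a b 0 = 1`. Solving for it leaves only Taylor coefficients and earlier zeta values. -/
theorem isRationalInParameters_hypergeometricZeta (n : ℕ) :
    IsRationalInParameters fun a b => hypergeometricZeta a b ((n + 2 : ℕ) : ℂ) := by
  induction n using Nat.strong_induction_on with
  | _ n ih =>
    have hsum : IsRationalInParameters fun a b => ∑ i ∈ Finset.range n,
        ((n + 1).descFactorial (i + 1) : ℚ) * hypergeometricZeta a b ((i + 2 : ℕ) : ℂ) *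
          kummerCoeff a b (n + 1 - (i + 1)) :=
      .sum _ fun i hi => ((IsRationalInParameters.ratCast _).mul (ih i (Finset.mem_range.1 hi))).mul
        (isRationalInParameters_kummerCoeff _)
    refine ((IsRationalInParameters.ratCast (1 / (n + 1).factorial)).mul
      ((((isRationalInParameters_kummerCoeff 1).mul (isRationalInParameters_kummerCoeff (n + 1))).sub
        (isRationalInParameters_kummerCoeff (n + 2))).sub hsum)).congr fun a b ha hb => ?_
    have hrec := kummerCoeff_succ_eq_sub_sum ha hb (n + 1)
    rw [Finset.sum_range_succ, Nat.descFactorial_self, Nat.sub_self, kummerCoeff_zero] at hrec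
    have hf : ((n + 1).factorial : ℂ) ≠ 0 := by exact_mod_cast (n + 1).factorial_ne_zero
    push_cast at hrec ⊢
    rw [one_div, eq_inv_mul_iff_mul_eq₀ hf]
    linear_combination hrec

end

theorem mainTheorem4 :
    (∀ a b : ℝ, 0 < a → 0 < b →
      (∀ n : ℕ, 2 ≤ n → Summable (hypergeometricZetaTerm a b (n : ℂ))) ∧
      (∀ p : ℕ, 1 ≤ p →
        ∑ l ∈ Finset.Icc 1 p,
            Complex.betaIntegral ((a : ℂ) + (p : ℂ) - (l : ℂ)) (b : ℂ) *
              ((Nat.factorial p : ℂ) / (Nat.factorial (p - l) : ℂ)) *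
              hypergeometricZeta a b ((l : ℂ) + 1) =
          -((b : ℂ) * (p : ℂ) / (((a : ℂ) + (b : ℂ)) * ((a : ℂ) + (b : ℂ) + (p : ℂ)))) *
            Complex.betaIntegral ((a : ℂ) + (p : ℂ)) (b : ℂ))) ∧
    (∀ n : ℕ, 2 ≤ n → ∃ P Q : MvPolynomial (Fin 2) ℚ, ∀ a b : ℝ, 0 < a → 0 < b →
      MvPolynomial.aeval ![(a : ℂ), (b : ℂ)] Q ≠ 0 ∧
      hypergeometricZeta a b (n : ℂ) =
        MvPolynomial.aeval ![(a : ℂ), (b : ℂ)] P /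
          MvPolynomial.aeval ![(a : ℂ), (b : ℂ)] Q) := by
  refine ⟨fun a b ha hb => ⟨fun n hn => summable_hypergeometricZetaTerm ha hb hn,
    fun p _ => sum_betaIntegral_mul_hypergeometricZeta ha hb p⟩, fun n hn => ?_⟩
  obtain ⟨n, rfl⟩ := Nat.exists_eq_add_of_le' hn
  exact isRationalInParameters_hypergeometricZeta n
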